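/- Let $(R,\mathfrak m)$ be a noetherian local ring. For a finitely generated $R$-module $M$ let $F$ be the minimal free resolution of $M$, filtered by $(\mathcal G^nF)_i=\mathfrak m^{n-i}F_i$ (where $\mathfrak m^j=R$ for $j\le 0$). The linear part $\operatorname{lin}^R F$ is the associated graded complex $\bigoplus_n \mathcal G^nF/\mathcal G^{n+1}F$, and the linearity defect of $M$ is $$\operatorname{ld}_R M=\sup\{i : H_i(\operatorname{lin}^R F)\neq 0\},$$ with $\operatorname{ld}_R 0=0$. A noetherian local ring $R$ is called absolutely Koszul if $\operatorname{ld}_R M<\infty$ for every finitely generated $R$-module $M$. Let $(R,\mathfrak m)$ be an absolutely Koszul (noetherian) local ring, and let $x\in\mathfrak m\setminus\mathfrak m^2$ be an element whose class $\overline x\in\mathfrak m/\mathfrak m^2$ is a non-zero-divisor on the associated graded ring $\operatorname{gr}_{\mathfrak m}R=\bigoplus_{n\ge 0}\mathfrak m^n/\mathfrak m^{n+1}$. Then $R/(x)$ is a (noetherian) local ring which is again absolutely Koszul. -/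

import Mathlib

open scoped DirectSum

universe u v

section AssociatedGraded

variable {R : Type u} [CommRing R] (I : Ideal R)

/-- The degree `n` piece `Iⁿ / Iⁿ⁺¹` of the associated graded ring of the ideal `I`. -/
abbrev Ideal.GrPiece (n : ℕ) : Type u :=
  ↥(I ^ n) ⧸ (I ^ (n + 1)).submoduleOf (I ^ n)

/-- The class in `Iⁿ / Iⁿ⁺¹` of an element `a` of `Iⁿ`. -/
def Ideal.grMk (n : ℕ) (a : R) (ha : a ∈ I ^ n) : I.GrPiece n :=
  Submodule.Quotient.mk ⟨a, ha⟩

namespace Ideal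

variable {I}

theorem grMk_eq_grMk {n : ℕ} {a b : R} {ha : a ∈ I ^ n} {hb : b ∈ I ^ n} :
    I.grMk n a ha = I.grMk n b hb ↔ a - b ∈ I ^ (n + 1) :=
  Submodule.Quotient.eq _

theorem exists_grMk {n : ℕ} (q : I.GrPiece n) : ∃ a ha, I.grMk n a ha = q := by
  obtain ⟨⟨a, ha⟩, rfl⟩ := Submodule.Quotient.mk_surjective _ q
  exact ⟨a, ha, rfl⟩

theorem mul_mem_pow_add {i j : ℕ} {a b : R} (ha : a ∈ I ^ i) (hb : b ∈ I ^ j) :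
    a * b ∈ I ^ (i + j) := by
  rw [pow_add]
  exact Ideal.mul_mem_mul ha hb

/-- Multiplication `Iⁱ / Iⁱ⁺¹ × Iʲ / Iʲ⁺¹ → Iⁱ⁺ʲ / Iⁱ⁺ʲ⁺¹`, induced by that of `R`. -/
def grMul {i j : ℕ} : I.GrPiece i → I.GrPiece j → I.GrPiece (i + j) :=
  Quotient.map₂ (fun a b => ⟨(a : R) * b, mul_mem_pow_add a.2 b.2⟩) (by
    intro a a' h b b' h'
    replace h : (a : R) - a' ∈ I ^ (i + 1) := (Submodule.quotientRel_def ((I ^ (i + 1)).submoduleOf (I ^ i))).1 h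
    replace h' : (b : R) - b' ∈ I ^ (j + 1) := (Submodule.quotientRel_def ((I ^ (j + 1)).submoduleOf (I ^ j))).1 h'
    refine (Submodule.quotientRel_def
      ((I ^ (i + j + 1)).submoduleOf (I ^ (i + j)))).2 ?_
    change (a : R) * b - a' * b' ∈ I ^ (i + j + 1)
    have e : (a : R) * b - a' * b' = (a - a') * b + a' * (b - b') := by ring
    have h1 : ((a : R) - a') * b ∈ I ^ (i + j + 1) := by
      have := mul_mem_pow_add h b.2
      rwa [show i + 1 + j = i + j + 1 by omega] at this
    have h2 : (a' : R) * (b - b') ∈ I ^ (i + j + 1) :=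
      mul_mem_pow_add (i := i) (j := j + 1) a'.2 h'
    exact e ▸ add_mem h1 h2)

theorem grMul_grMk {i j : ℕ} {a b : R} (ha : a ∈ I ^ i) (hb : b ∈ I ^ j) :
    grMul (I.grMk i a ha) (I.grMk j b hb) = I.grMk (i + j) (a * b) (mul_mem_pow_add ha hb) :=
  rfl

theorem grMk_add {n : ℕ} {a b : R} (ha : a ∈ I ^ n) (hb : b ∈ I ^ n) :
    I.grMk n a ha + I.grMk n b hb = I.grMk n (a + b) (add_mem ha hb) :=
  rfl

theorem grMk_zero {n : ℕ} : I.grMk n 0 (zero_mem _) = 0 :=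
  rfl

theorem grMk_sigma_congr {i j : ℕ} {a b : R} {ha : a ∈ I ^ i} {hb : b ∈ I ^ j}
    (h : i = j) (h' : a = b) :
    (GradedMonoid.mk i (I.grMk i a ha) : GradedMonoid I.GrPiece) =
      GradedMonoid.mk j (I.grMk j b hb) := by
  subst h
  subst h'
  rfl

instance : GradedMonoid.GMul I.GrPiece := ⟨grMul⟩

instance : GradedMonoid.GOne I.GrPiece := ⟨I.grMk 0 1 (by simp)⟩

theorem mk_mul_grMk {i j : ℕ} {a b : R} (ha : a ∈ I ^ i) (hb : b ∈ I ^ j) :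
    (GradedMonoid.mk i (I.grMk i a ha) * GradedMonoid.mk j (I.grMk j b hb) :
      GradedMonoid I.GrPiece) =
      GradedMonoid.mk (i + j) (I.grMk (i + j) (a * b) (mul_mem_pow_add ha hb)) :=
  rfl

theorem gradedMonoid_one_eq :
    (1 : GradedMonoid I.GrPiece) = GradedMonoid.mk 0 (I.grMk 0 1 (by simp)) :=
  rfl

/-- The pieces `Iⁿ / Iⁿ⁺¹` form a commutative graded ring. -/
instance : DirectSum.GCommRing I.GrPiece where
  one_mul := by
    rintro ⟨i, q⟩
    obtain ⟨a, ha, rfl⟩ := exists_grMk q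
    exact (mk_mul_grMk _ _).trans (grMk_sigma_congr (zero_add i) (one_mul a))
  mul_one := by
    rintro ⟨i, q⟩
    obtain ⟨a, ha, rfl⟩ := exists_grMk q
    exact (mk_mul_grMk _ _).trans (grMk_sigma_congr (add_zero i) (mul_one a))
  mul_assoc := by
    rintro ⟨i, p⟩ ⟨j, q⟩ ⟨k, r⟩
    obtain ⟨a, ha, rfl⟩ := exists_grMk p
    obtain ⟨b, hb, rfl⟩ := exists_grMk q
    obtain ⟨c, hc, rfl⟩ := exists_grMk r
    exact grMk_sigma_congr (ha := mul_mem_pow_add (mul_mem_pow_add ha hb) hc)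
      (hb := mul_mem_pow_add ha (mul_mem_pow_add hb hc)) (add_assoc i j k) (mul_assoc a b c)
  mul_comm := by
    rintro ⟨i, p⟩ ⟨j, q⟩
    obtain ⟨a, ha, rfl⟩ := exists_grMk p
    obtain ⟨b, hb, rfl⟩ := exists_grMk q
    exact grMk_sigma_congr (ha := mul_mem_pow_add ha hb) (hb := mul_mem_pow_add hb ha)
      (add_comm i j) (mul_comm a b)
  mul_zero := by
    intro i j p
    obtain ⟨a, ha, rfl⟩ := exists_grMk p
    exact grMk_eq_grMk.2 (by simp)
  zero_mul := by
    intro i j p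
    obtain ⟨a, ha, rfl⟩ := exists_grMk p
    exact grMk_eq_grMk.2 (by simp)
  mul_add := by
    intro i j p q r
    obtain ⟨a, ha, rfl⟩ := exists_grMk p
    obtain ⟨b, hb, rfl⟩ := exists_grMk q
    obtain ⟨c, hc, rfl⟩ := exists_grMk r
    exact grMk_eq_grMk.2 (by simp [mul_add])
  add_mul := by
    intro i j p q r
    obtain ⟨a, ha, rfl⟩ := exists_grMk p
    obtain ⟨b, hb, rfl⟩ := exists_grMk q
    obtain ⟨c, hc, rfl⟩ := exists_grMk r
    exact grMk_eq_grMk.2 (by simp [add_mul])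
  natCast n := I.grMk 0 n (by simp)
  natCast_zero := grMk_eq_grMk.2 (by simp)
  natCast_succ n := grMk_eq_grMk.2 (by simp)
  intCast n := I.grMk 0 n (by simp)
  intCast_ofNat n := grMk_eq_grMk.2 (by simp)
  intCast_negSucc_ofNat n := grMk_eq_grMk.2 (by simp)

variable (I)

/-- The associated graded ring `gr_I R = ⨁ₙ Iⁿ / Iⁿ⁺¹`, with its usual multiplication. -/
abbrev AssociatedGradedRing : Type u :=
  ⨁ n : ℕ, I.GrPiece n

/-- The class in `I / I² ⊆ gr_I R` (degree one) of an element `x` of `I`. -/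
noncomputable def degreeOneClass (x : R) (hx : x ∈ I) : I.AssociatedGradedRing :=
  DirectSum.of I.GrPiece 1 (I.grMk 1 x (by simpa using hx))

end Ideal

end AssociatedGraded

section LinearityDefect

open IsLocalRing CategoryTheory

variable (R : Type u) [CommRing R] [IsLocalRing R]

/-- A minimal free resolution `⋯ → F₂ → F₁ → F₀ → M → 0` of `M` over the local ring `R`:
the modules `Fᵢ = R ^ rank i` are free of finite rank, the augmented complex is exact,
and `d Fᵢ₊₁ ⊆ 𝔪 Fᵢ` for all `i`. -/
structure MinimalFreeResolution (M : Type v) [AddCommGroup M] [Module R M] where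
  /-- the Betti numbers -/
  rank : ℕ → ℕ
  /-- the differential `Fᵢ₊₁ → Fᵢ` -/
  d : ∀ i, (Fin (rank (i + 1)) → R) →ₗ[R] (Fin (rank i) → R)
  /-- the augmentation `F₀ → M` -/
  aug : (Fin (rank 0) → R) →ₗ[R] M
  aug_surjective : Function.Surjective aug
  exact_aug : Function.Exact (d 0) aug
  exact_d : ∀ i, Function.Exact (d (i + 1)) (d i)
  minimal : ∀ i, LinearMap.range (d i) ≤ maximalIdeal R • ⊤

/-- A finitely generated module has a surjection from a free module of finite rank whose kernel
lies in `𝔪` times the free module. -/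
theorem exists_minimal_cover (M : Type v) [AddCommGroup M] [Module R M] [Module.Finite R M] :
    ∃ (n : ℕ) (f : (Fin n → R) →ₗ[R] M), Function.Surjective f ∧
      LinearMap.ker f ≤ maximalIdeal R • ⊤ := by
  let b := Module.finBasis (ResidueField R) (TensorProduct R (ResidueField R) M)
  obtain ⟨v, hv⟩ := (TensorProduct.mk_surjective R M (ResidueField R)
    Ideal.Quotient.mk_surjective).comp_left b
  refine ⟨_, Fintype.linearCombination R v, ?_, ?_⟩
  · rw [← LinearMap.range_eq_top, Fintype.range_linearCombination]
    exact span_eq_top_of_tmul_eq_basis v b fun i => congr_fun hv i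
  · intro r hr
    have h0 : ∑ i, residue R (r i) • b i = 0 := by
      have h1 := congrArg (TensorProduct.mk R (ResidueField R) M 1) (LinearMap.mem_ker.1 hr)
      rw [Fintype.linearCombination_apply, map_sum, map_zero] at h1
      rw [← h1]
      refine Finset.sum_congr rfl fun i _ => ?_
      rw [map_smul, ← congr_fun hv i]
      exact algebraMap_smul (ResidueField R) (r i) _
    have h2 : ∀ i, r i ∈ maximalIdeal R := fun i =>
      (residue_eq_zero_iff _).1 (Fintype.linearIndependent_iff.1 b.linearIndependent _ h0 i)
    rw [pi_eq_sum_univ' r]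
    exact Submodule.sum_mem _ fun i _ => Submodule.smul_mem_smul (h2 i) trivial

/-- Over a noetherian local ring every finitely generated module has a minimal free
resolution. -/
theorem MinimalFreeResolution.nonempty [IsNoetherianRing R] (M : Type v) [AddCommGroup M]
    [Module R M] [Module.Finite R M] : Nonempty (MinimalFreeResolution R M) := by
  obtain ⟨n₀, f₀, hs₀, hk₀⟩ := exists_minimal_cover R M
  have key : ∀ (n : ℕ) (K : Submodule R (Fin n → R)), ∃ (m : ℕ)
      (g : (Fin m → R) →ₗ[R] (Fin n → R)), LinearMap.range g = K ∧
        LinearMap.ker g ≤ maximalIdeal R • ⊤ := by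
    intro n K
    obtain ⟨m, g, hs, hk⟩ := exists_minimal_cover R K
    refine ⟨m, K.subtype ∘ₗ g, ?_, ?_⟩
    · rw [LinearMap.range_comp, LinearMap.range_eq_top.2 hs, Submodule.map_top,
        Submodule.range_subtype]
    · rwa [LinearMap.ker_comp_of_ker_eq_bot _ K.ker_subtype]
  choose m g hr hk using key
  let S := Σ n : ℕ, {K : Submodule R (Fin n → R) // K ≤ maximalIdeal R • ⊤}
  let next : S → S := fun s => ⟨m s.1 s.2.1, LinearMap.ker (g s.1 s.2.1), hk _ _⟩
  let s : ℕ → S := fun i => Nat.rec ⟨n₀, LinearMap.ker f₀, hk₀⟩ (fun _ t => next t) i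
  exact ⟨{
    rank := fun i => (s i).1
    d := fun i => g (s i).1 (s i).2.1
    aug := f₀
    aug_surjective := hs₀
    exact_aug := LinearMap.exact_iff.2 (hr _ _).symm
    exact_d := fun i => LinearMap.exact_iff.2 (hr _ _).symm
    minimal := fun i => (hr _ _).trans_le (s i).2.2 }⟩

namespace MinimalFreeResolution

variable {R} {M : Type v} [AddCommGroup M] [Module R M] (F : MinimalFreeResolution R M)

/-- The free module `Fᵢ`. -/
abbrev X (i : ℕ) : Type u := Fin (F.rank i) → R

/-- The filtration `(𝒢ⁿF)ᵢ = 𝔪ⁿ⁻ⁱ Fᵢ`, where `𝔪ʲ = R` for `j ≤ 0`; the subtraction of natural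
numbers, which is `0` for `n ≤ i`, does exactly this. (For `n < 0` one would get `Fᵢ` again, so
the quotients of the filtration in negative degrees vanish.) -/
def filtration (n i : ℕ) : Submodule R (F.X i) :=
  maximalIdeal R ^ (n - i) • ⊤

theorem d_mem_filtration (n i : ℕ) :
    ∀ a ∈ F.filtration n (i + 1), F.d i a ∈ F.filtration n i := by
  intro a ha
  unfold filtration at ha ⊢
  have h1 : F.d i a ∈ (maximalIdeal R ^ (n - (i + 1)) • ⊤ : Submodule R (F.X (i + 1))).map (F.d i) :=
    Submodule.mem_map_of_mem ha
  rw [Submodule.map_smul'', Submodule.map_top] at h1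
  have h2 := Submodule.smul_mono (le_refl (maximalIdeal R ^ (n - (i + 1)))) (F.minimal i) h1
  rw [← smul_assoc, smul_eq_mul, ← pow_succ] at h2
  exact Submodule.smul_mono_left (Ideal.pow_le_pow_right (by omega)) h2

/-- The quotient `(𝒢ⁿF)ᵢ / (𝒢ⁿ⁺¹F)ᵢ`. -/
def GrX (n i : ℕ) : Type u :=
  ↥(F.filtration n i) ⧸ (F.filtration (n + 1) i).submoduleOf (F.filtration n i)

instance (n i : ℕ) : AddCommGroup (F.GrX n i) :=
  inferInstanceAs (AddCommGroup
    (↥(F.filtration n i) ⧸ (F.filtration (n + 1) i).submoduleOf (F.filtration n i)))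

instance (n i : ℕ) : Module R (F.GrX n i) :=
  inferInstanceAs (Module R
    (↥(F.filtration n i) ⧸ (F.filtration (n + 1) i).submoduleOf (F.filtration n i)))

/-- The map `(𝒢ⁿF)ᵢ₊₁ / (𝒢ⁿ⁺¹F)ᵢ₊₁ → (𝒢ⁿF)ᵢ / (𝒢ⁿ⁺¹F)ᵢ` induced by the differential. -/
def grD (n i : ℕ) : F.GrX n (i + 1) →ₗ[R] F.GrX n i :=
  Submodule.mapQ _ _ ((F.d i).restrict (F.d_mem_filtration n i))
    fun a ha => F.d_mem_filtration (n + 1) i a ha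

theorem grD_comp_grD (n i : ℕ) : F.grD n i ∘ₗ F.grD n (i + 1) = 0 := by
  refine LinearMap.ext fun q => ?_
  obtain ⟨a, rfl⟩ := Submodule.Quotient.mk_surjective _ q
  refine (Submodule.Quotient.mk_eq_zero _).2 ?_
  change F.d i (F.d (i + 1) a) ∈ F.filtration (n + 1) i
  rw [(F.exact_d i).apply_apply_eq_zero]
  exact zero_mem _

/-- The linear part of `F`: the associated graded complex
`⨁ₙ 𝒢ⁿF / 𝒢ⁿ⁺¹F` of the filtration `𝒢`. -/
noncomputable def linearPart : ChainComplex (ModuleCat.{u} R) ℕ :=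
  ChainComplex.of (fun i => ModuleCat.of R (⨁ n, F.GrX n i))
    (fun i => ModuleCat.ofHom (DirectSum.lmap fun n => F.grD n i)) fun i => by
      rw [← ModuleCat.ofHom_comp, ← DirectSum.lmap_comp]
      refine ModuleCat.hom_ext (LinearMap.ext fun x => DFinsupp.ext fun n => ?_)
      exact LinearMap.congr_fun (F.grD_comp_grD n i) (x n)

/-- `sup {i : Hᵢ(lin F) ≠ 0}`, with `sup ∅ = 0`. -/
noncomputable def linearityDefect : ℕ∞ :=
  ⨆ (i : ℕ) (_ : ¬ Limits.IsZero (F.linearPart.homology i)), (i : ℕ∞)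

end MinimalFreeResolution

/-- The linearity defect `ld_R M = sup {i : Hᵢ(lin F) ≠ 0}`, where `F` is the minimal free
resolution of `M`. Any two minimal free resolutions of `M` are isomorphic, so the outer supremum
is over copies of one value. For `M = 0` the value is `0`. -/
noncomputable def linearityDefect (M : Type v) [AddCommGroup M] [Module R M] : ℕ∞ :=
  ⨆ F : MinimalFreeResolution R M, F.linearityDefect

/-- A noetherian local ring is absolutely Koszul if all its finitely generated modules have finite
linearity defect. -/
def IsAbsolutelyKoszul (R : Type u) [CommRing R] [IsLocalRing R] [IsNoetherianRing R] : Prop :=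
  ∀ (M : Type u) [AddCommGroup M] [Module R M] [Module.Finite R M], linearityDefect R M < ⊤

end LinearityDefect

/-! Put `S = R/(x)` and let `G` be a minimal free resolution over `S` of an `S`-module `M`. Lift its
differentials to maps `d` over `R`; then `d² = x·t` for some maps `t`. On `Fᵢ = R^{gᵢ} ⊕ R^{gᵢ₋₁}`,
where `gᵢ` is the rank of `Gᵢ`, the differential `(a, b) ↦ (d a + x b, -(t a + d b))` defines a
minimal free resolution `F` of `M` over `R`.

The second coordinate of a boundary is governed by the first: `x` times it is `-d` of the first
(`shiftD_coneD`). Regularity of the class of `x` on the associated graded ring means that `x y ∈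
𝔪ᵏ⁺¹` forces `y ∈ 𝔪ᵏ`. Hence a boundary lies as deep in the filtration as its first coordinate
requires (`coneD_snd_mem`), and it vanishes if that coordinate does.

A cycle of `lin G` in positive degree therefore lifts to a cycle of `lin F`. If the latter bounds,
first coordinates modulo `x` show that the former bounds (`isZero_homology_linearPart`). So `ld_S M
≤ ld_R M`, and finiteness passes from `R` to `S`. -/

open IsLocalRing CategoryTheory

/-! ### Ideal powers times free modules, in coordinates. -/

section Pi

variable {R : Type u} [CommRing R] {n : ℕ}

theorem Ideal.mem_smul_top_fin_pi {I : Ideal R} {y : Fin n → R} :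
    y ∈ (I • ⊤ : Submodule R (Fin n → R)) ↔ ∀ i, y i ∈ I := by
  refine ⟨fun h i => ?_, fun h => ?_⟩
  · have h1 : (I • ⊤ : Submodule R (Fin n → R)) ≤ Submodule.comap (LinearMap.proj i) I :=
      Submodule.smul_le.2 fun r hr a _ => I.mul_mem_right (a i) hr
    exact h1 h
  · rw [pi_eq_sum_univ' y]
    exact Submodule.sum_mem _ fun i _ => Submodule.smul_mem_smul (h i) trivial

theorem LinearMap.map_mem_pow_succ_smul_top {n' : ℕ} {I : Ideal R}
    {f : (Fin n → R) →ₗ[R] (Fin n' → R)} (hf : ∀ a, f a ∈ (I • ⊤ : Submodule R (Fin n' → R)))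
    {k : ℕ} {a : Fin n → R} (ha : a ∈ (I ^ k • ⊤ : Submodule R (Fin n → R))) :
    f a ∈ (I ^ (k + 1) • ⊤ : Submodule R (Fin n' → R)) := by
  have h1 := Submodule.mem_map_of_mem (f := f) ha
  rw [Submodule.map_smul'', Submodule.map_top] at h1
  have h2 := Submodule.smul_mono (le_refl (I ^ k)) (show LinearMap.range f ≤ I • ⊤ by
    rintro _ ⟨b, rfl⟩
    exact hf b) h1
  rwa [← smul_assoc, smul_eq_mul, ← pow_succ] at h2

/-- The decomposition of a free module of rank `m + n`. -/
def finAddPiEquiv (R : Type u) [CommRing R] (m n : ℕ) :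
    (Fin (m + n) → R) ≃ₗ[R] (Fin m → R) × (Fin n → R) :=
  (LinearEquiv.funCongrLeft R R finSumFinEquiv).trans (LinearEquiv.sumArrowLequivProdArrow _ _ R R)

theorem finAddPiEquiv_mem_smul_top {I : Ideal R} {m n : ℕ} {y : Fin (m + n) → R} :
    y ∈ (I • ⊤ : Submodule R (Fin (m + n) → R)) ↔
      (finAddPiEquiv R m n y).1 ∈ (I • ⊤ : Submodule R (Fin m → R)) ∧
      (finAddPiEquiv R m n y).2 ∈ (I • ⊤ : Submodule R (Fin n → R)) := by
  simp only [Ideal.mem_smul_top_fin_pi]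
  exact Fin.forall_fin_add (P := fun i => y i ∈ I)

end Pi

/-! ### Consequences of regularity on the associated graded ring. -/

section Regular

variable {R : Type u} [CommRing R]

/-- Climb one power at a time: if `y ∈ Iʲ` with `j < k`, then `x y ∈ Iʲ⁺²`, so the class of `y` in
degree `j` is killed by that of `x`. It is therefore zero, that is, `y ∈ Iʲ⁺¹`. -/
theorem Ideal.mem_pow_of_mul_mem_pow_succ {I : Ideal R} {x : R} (hx : x ∈ I)
    (hreg : I.degreeOneClass x hx ∈ nonZeroDivisors I.AssociatedGradedRing) {k : ℕ} {y : R}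
    (h : x * y ∈ I ^ (k + 1)) : y ∈ I ^ k := by
  have key : ∀ j ≤ k, y ∈ I ^ j := by
    intro j
    induction j with
    | zero => simp
    | succ j ih =>
      intro hj
      have hy := ih (by omega)
      have h0 : DirectSum.of I.GrPiece j (I.grMk j y hy) = 0 := by
        refine (mem_nonZeroDivisors_iff.1 hreg).1 _ ?_
        unfold Ideal.degreeOneClass
        rw [DirectSum.of_mul_of]
        have : (GradedMonoid.GMul.mul (I.grMk 1 x (by simpa using hx)) (I.grMk j y hy) :
            I.GrPiece (1 + j)) = 0 := by
          refine Ideal.grMk_eq_grMk (hb := zero_mem _).2 ?_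
          rw [sub_zero]
          exact Ideal.pow_le_pow_right (by omega) h
        rw [this, map_zero]
      have h1 : I.grMk j y hy = 0 := DirectSum.of_injective j (h0.trans (map_zero _).symm)
      simpa using (Ideal.grMk_eq_grMk (hb := zero_mem _)).1 h1
  exact key k le_rfl

theorem Ideal.smul_mem_pow_smul_top {I : Ideal R} {x : R} (hx : x ∈ I)
    (hreg : I.degreeOneClass x hx ∈ nonZeroDivisors I.AssociatedGradedRing) {n k : ℕ}
    {y : Fin n → R} (h : x • y ∈ (I ^ (k + 1) • ⊤ : Submodule R (Fin n → R))) :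
    y ∈ (I ^ k • ⊤ : Submodule R (Fin n → R)) := by
  rw [Ideal.mem_smul_top_fin_pi] at h ⊢
  exact fun i => Ideal.mem_pow_of_mul_mem_pow_succ hx hreg (h i)

/-- By the preceding lemma `y` lies in every `𝔪ᵏ Rⁿ`, and Krull's intersection theorem applies. -/
theorem IsLocalRing.smul_pi_eq_zero [IsLocalRing R] [IsNoetherianRing R] {x : R}
    (hx : x ∈ maximalIdeal R) (hreg : (maximalIdeal R).degreeOneClass x hx ∈
      nonZeroDivisors (maximalIdeal R).AssociatedGradedRing) {n : ℕ} {y : Fin n → R}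
    (h : x • y = 0) : y = 0 := by
  have h1 : y ∈ (⨅ k : ℕ, maximalIdeal R ^ k • ⊤ : Submodule R (Fin n → R)) := by
    rw [Submodule.mem_iInf]
    intro k
    exact Ideal.smul_mem_pow_smul_top hx hreg (h ▸ zero_mem _)
  rwa [Ideal.iInf_pow_smul_eq_bot_of_isLocalRing _ (Ideal.IsPrime.ne_top inferInstance)] at h1

end Regular

namespace MinimalFreeResolution

/-! ### Exactness of the linear part in terms of elements. -/

section Exactness

variable {R : Type u} [CommRing R] [IsLocalRing R] {M : Type v} [AddCommGroup M] [Module R M]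
  (F : MinimalFreeResolution R M)

theorem linearPart_d (i : ℕ) : F.linearPart.d (i + 1) i =
    ModuleCat.ofHom (DirectSum.lmap fun n => F.grD n i) :=
  ChainComplex.of_d (fun i => ModuleCat.of R (⨁ n, F.GrX n i))
    (fun i => ModuleCat.ofHom (DirectSum.lmap fun n => F.grD n i)) i

/-- The differential of the linear part is diagonal in the filtration degree `n`, so exactness can
be tested degree by degree. -/
theorem isZero_homology_linearPart_iff (j : ℕ) :
    Limits.IsZero (F.linearPart.homology (j + 1)) ↔
      ∀ n, ∀ q, F.grD n j q = 0 → ∃ p, F.grD n (j + 1) p = q := by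
  rw [← HomologicalComplex.exactAt_iff_isZero_homology,
    HomologicalComplex.exactAt_iff' _ (j + 1 + 1) (j + 1) j (by simp) (by simp),
    ShortComplex.moduleCat_exact_iff]
  change (∀ y, F.linearPart.d (j + 1) j y = 0 →
    ∃ z, F.linearPart.d (j + 1 + 1) (j + 1) z = y) ↔ _
  rw [linearPart_d, linearPart_d]
  change (∀ y : ⨁ n, F.GrX n (j + 1), DirectSum.lmap (fun n => F.grD n j) y = 0 →
    ∃ z : ⨁ n, F.GrX n (j + 1 + 1), DirectSum.lmap (fun n => F.grD n (j + 1)) z = y) ↔ _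
  refine ⟨fun h n q hq => ?_, fun h y hy => ?_⟩
  · obtain ⟨z, hz⟩ := h (DirectSum.lof R ℕ (fun n => F.GrX n (j + 1)) n q) (by
      rw [DirectSum.lmap_lof, hq, map_zero])
    refine ⟨z n, ?_⟩
    have h1 := DFunLike.congr_fun hz n
    rw [DirectSum.lmap_apply] at h1
    rw [h1]
    exact DirectSum.of_eq_same _ _
  · classical
    have h1 : ∀ n, F.grD n j (y n) = 0 := fun n => by
      have := DFunLike.congr_fun hy n
      rwa [DirectSum.lmap_apply] at this
    choose p hp using fun n => h n (y n) (h1 n)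
    refine ⟨∑ n ∈ DFinsupp.support y, DirectSum.lof R ℕ _ n (p n), ?_⟩
    rw [map_sum]
    simp_rw [DirectSum.lmap_lof, hp]
    exact DirectSum.sum_support_of y

theorem grX_mk_eq_mk {n i : ℕ} {a b : F.filtration n i} :
    (Submodule.Quotient.mk a : F.GrX n i) = Submodule.Quotient.mk b ↔
      (a : F.X i) - b ∈ F.filtration (n + 1) i :=
  Submodule.Quotient.eq _

theorem grX_mk_eq_zero {n i : ℕ} {a : F.filtration n i} :
    (Submodule.Quotient.mk a : F.GrX n i) = 0 ↔ (a : F.X i) ∈ F.filtration (n + 1) i :=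
  Submodule.Quotient.mk_eq_zero _

theorem isZero_homology_linearPart_iff_forall_mem (j : ℕ) :
    Limits.IsZero (F.linearPart.homology (j + 1)) ↔
      ∀ n, ∀ a ∈ F.filtration n (j + 1), F.d j a ∈ F.filtration (n + 1) j →
        ∃ b ∈ F.filtration n (j + 2), a - F.d (j + 1) b ∈ F.filtration (n + 1) (j + 1) := by
  rw [isZero_homology_linearPart_iff]
  refine forall_congr' fun n => ⟨fun h a ha hda => ?_, fun h q hq => ?_⟩
  · obtain ⟨p, hp⟩ := h (Submodule.Quotient.mk ⟨a, ha⟩) (F.grX_mk_eq_zero.2 hda)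
    obtain ⟨⟨b, hb⟩, rfl⟩ := Submodule.Quotient.mk_surjective _ p
    exact ⟨b, hb, F.grX_mk_eq_mk.1 hp.symm⟩
  · obtain ⟨⟨a, ha⟩, rfl⟩ := Submodule.Quotient.mk_surjective _ q
    obtain ⟨b, hb, hab⟩ := h a ha (F.grX_mk_eq_zero.1 hq)
    exact ⟨Submodule.Quotient.mk ⟨b, hb⟩, (F.grX_mk_eq_mk.2 hab).symm⟩

end Exactness

/-! ### Reduction of free modules from `R` to `S = R/(x)`. -/

section Reduction

variable (R : Type u) [CommRing R] (S : Type u) [CommRing S] [Algebra R S]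

/-- Coordinatewise reduction `Rⁿ → Sⁿ`. -/
def piReduction (n : ℕ) : (Fin n → R) →ₗ[R] (Fin n → S) :=
  (Algebra.linearMap R S).compLeft (Fin n)

variable {R S}

theorem piReduction_apply {n : ℕ} (a : Fin n → R) (i : Fin n) :
    piReduction R S n a i = algebraMap R S (a i) :=
  rfl

theorem piReduction_surjective (hS : Function.Surjective (algebraMap R S)) (n : ℕ) :
    Function.Surjective (piReduction R S n) :=
  hS.comp_left

theorem piReduction_smul_eq_zero {x : R} (hxS : RingHom.ker (algebraMap R S) = Ideal.span {x})
    {n : ℕ} (a : Fin n → R) : piReduction R S n (x • a) = 0 := by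
  have : algebraMap R S x = 0 := by
    rw [← RingHom.mem_ker, hxS]
    exact Ideal.mem_span_singleton_self x
  ext i
  simp [piReduction_apply, this]

theorem exists_smul_eq_of_piReduction_eq_zero {x : R}
    (hxS : RingHom.ker (algebraMap R S) = Ideal.span {x}) {n : ℕ} {a : Fin n → R}
    (ha : piReduction R S n a = 0) : ∃ b, a = x • b := by
  have h : ∀ i, ∃ c, a i = x * c := fun i => by
    rw [← dvd_def, ← Ideal.mem_span_singleton, ← hxS, RingHom.mem_ker]
    exact congr_fun ha i
  choose b hb using h
  exact ⟨b, funext hb⟩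

variable [IsLocalRing R] [IsLocalRing S]

theorem map_maximalIdeal_of_surjective (hS : Function.Surjective (algebraMap R S)) :
    (maximalIdeal R).map (algebraMap R S) = maximalIdeal S := by
  have := IsLocalHom.of_surjective (algebraMap R S) hS
  rw [← maximalIdeal_comap (algebraMap R S), Ideal.map_comap_of_surjective _ hS]

theorem piReduction_mem (hS : Function.Surjective (algebraMap R S)) {n k : ℕ} {a : Fin n → R}
    (ha : a ∈ (maximalIdeal R ^ k • ⊤ : Submodule R (Fin n → R))) :
    piReduction R S n a ∈ (maximalIdeal S ^ k • ⊤ : Submodule S (Fin n → S)) := by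
  rw [Ideal.mem_smul_top_fin_pi] at ha ⊢
  intro i
  rw [← map_maximalIdeal_of_surjective hS, ← Ideal.map_pow]
  exact Ideal.mem_map_of_mem _ (ha i)

theorem exists_mem_piReduction_eq (hS : Function.Surjective (algebraMap R S)) {n k : ℕ}
    {α : Fin n → S} (hα : α ∈ (maximalIdeal S ^ k • ⊤ : Submodule S (Fin n → S))) :
    ∃ a ∈ (maximalIdeal R ^ k • ⊤ : Submodule R (Fin n → R)), piReduction R S n a = α := by
  rw [Ideal.mem_smul_top_fin_pi] at hα
  have h : ∀ i, ∃ c ∈ maximalIdeal R ^ k, algebraMap R S c = α i := fun i => by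
    have := hα i
    rwa [← map_maximalIdeal_of_surjective hS, ← Ideal.map_pow,
      Ideal.mem_map_iff_of_surjective _ hS] at this
  choose a ha haα using h
  exact ⟨a, Ideal.mem_smul_top_fin_pi.2 ha, funext haα⟩

end Reduction

/-- The ranks of the shifted complex. -/
abbrev shiftRank (r : ℕ → ℕ) : ℕ → ℕ
  | 0 => 0
  | i + 1 => r i

/-! ### Lifting a resolution from `S` to `R`. -/

section Lift

variable {R : Type u} [CommRing R] {S : Type u} [CommRing S] [IsLocalRing S]
  [Algebra R S] {M : Type v} [AddCommGroup M] [Module S M]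

/-- A lift to `R` of the differential of a minimal free resolution over `S = R / (x)`,
together with the maps which express its square as a multiple of `x`. -/
structure Lift (x : R) (G : MinimalFreeResolution S M) where
  /-- the lifted maps -/
  d : ∀ i, (Fin (G.rank (i + 1)) → R) →ₗ[R] (Fin (G.rank i) → R)
  /-- the quotients of their squares by `x` -/
  t : ∀ i, (Fin (G.rank (i + 2)) → R) →ₗ[R] (Fin (G.rank i) → R)
  reduction_d : ∀ i a, piReduction R S _ (d i a) = G.d i (piReduction R S _ a)
  d_d : ∀ i a, d i (d (i + 1) a) = x • t i a

theorem Lift.nonempty {x : R} (G : MinimalFreeResolution S M)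
    (hS : Function.Surjective (algebraMap R S))
    (hxS : RingHom.ker (algebraMap R S) = Ideal.span {x}) : Nonempty (G.Lift x) := by
  choose d hd using fun i => Module.projective_lifting_property (piReduction R S (G.rank i))
    ((G.d i).restrictScalars R ∘ₗ piReduction R S (G.rank (i + 1))) (piReduction_surjective hS _)
  replace hd : ∀ i a, piReduction R S _ (d i a) = G.d i (piReduction R S _ a) :=
    fun i a => LinearMap.congr_fun (hd i) a
  have hsq : ∀ i a, d i (d (i + 1) a) ∈
      LinearMap.range (LinearMap.lsmul R (Fin (G.rank i) → R) x) := by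
    intro i a
    obtain ⟨b, hb⟩ := exists_smul_eq_of_piReduction_eq_zero (S := S) hxS
      (a := d i (d (i + 1) a)) (by rw [hd, hd, (G.exact_d i).apply_apply_eq_zero])
    exact ⟨b, hb.symm⟩
  -- Lifting along multiplication by `x` onto its range makes `t` linear without having to divide by
  -- `x`.
  choose t ht using fun i => Module.projective_lifting_property
    (LinearMap.lsmul R (Fin (G.rank i) → R) x).rangeRestrict
    ((d i ∘ₗ d (i + 1)).codRestrict _ (hsq i)) (LinearMap.surjective_rangeRestrict _)
  exact ⟨⟨d, t, hd, fun i a => (congrArg Subtype.val (LinearMap.congr_fun (ht i) a)).symm⟩⟩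

namespace Lift

variable {x : R} {G : MinimalFreeResolution S M} (L : G.Lift x)

/-- The lifted maps, shifted. -/
def shiftD : ∀ i, (Fin (G.rank i) → R) →ₗ[R] (Fin (shiftRank G.rank i) → R)
  | 0 => 0
  | i + 1 => L.d i

/-- The maps `t`, shifted. -/
def shiftT : ∀ i, (Fin (G.rank (i + 1)) → R) →ₗ[R] (Fin (shiftRank G.rank i) → R)
  | 0 => 0
  | i + 1 => L.t i

theorem shiftD_d (i : ℕ) (a : Fin (G.rank (i + 1)) → R) :
    L.shiftD i (L.d i a) = x • L.shiftT i a := by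
  cases i with
  | zero => simp [shiftD, shiftT]
  | succ i => exact L.d_d i a

/-- The differential of the resolution over `R`, on `Fᵢ = Rⁿ⁽ⁱ⁾ × Rⁿ⁽ⁱ⁻¹⁾`. -/
def coneD (i : ℕ) : (Fin (G.rank (i + 1)) → R) × (Fin (G.rank i) → R) →ₗ[R]
    (Fin (G.rank i) → R) × (Fin (shiftRank G.rank i) → R) :=
  (L.d i ∘ₗ LinearMap.fst R _ _ + x • LinearMap.snd R _ _).prod
    (-(L.shiftT i ∘ₗ LinearMap.fst R _ _ + L.shiftD i ∘ₗ LinearMap.snd R _ _))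

theorem coneD_apply (i : ℕ) (a : Fin (G.rank (i + 1)) → R) (b : Fin (G.rank i) → R) :
    L.coneD i (a, b) = (L.d i a + x • b, -(L.shiftT i a + L.shiftD i b)) :=
  rfl

/-- The key identity, obtained from `d² = x·t`. It gives `∂² = 0`, exactness, minimality and the
filtration estimate. -/
theorem shiftD_coneD (i : ℕ) (p : (Fin (G.rank (i + 1)) → R) × (Fin (G.rank i) → R)) :
    L.shiftD i (L.coneD i p).1 = -(x • (L.coneD i p).2) := by
  obtain ⟨a, b⟩ := p
  rw [coneD_apply, map_add, map_smul, L.shiftD_d, smul_neg, neg_neg, smul_add]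

variable [IsLocalRing R]

/-- Since `G` is minimal, `d a` agrees modulo `x` with a vector having entries in `𝔪`, and `x`
itself lies in `𝔪`. -/
theorem d_mem (hS : Function.Surjective (algebraMap R S))
    (hxS : RingHom.ker (algebraMap R S) = Ideal.span {x}) (hx : x ∈ maximalIdeal R)
    (i : ℕ) (a : Fin (G.rank (i + 1)) → R) :
    L.d i a ∈ (maximalIdeal R • ⊤ : Submodule R (Fin (G.rank i) → R)) := by
  have h1 : piReduction R S _ (L.d i a) ∈ (maximalIdeal S ^ 1 • ⊤ : Submodule S (G.X i)) := by
    rw [pow_one, L.reduction_d]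
    exact G.minimal i ⟨_, rfl⟩
  obtain ⟨e, he, h2⟩ := exists_mem_piReduction_eq hS h1
  obtain ⟨b, hb⟩ := exists_smul_eq_of_piReduction_eq_zero (S := S) hxS (a := L.d i a - e)
    (by rw [map_sub, h2, sub_self])
  rw [eq_add_of_sub_eq hb]
  exact add_mem (Submodule.smul_mem_smul hx trivial) (by simpa using he)

theorem shiftD_mem (hS : Function.Surjective (algebraMap R S))
    (hxS : RingHom.ker (algebraMap R S) = Ideal.span {x}) (hx : x ∈ maximalIdeal R)
    (i : ℕ) (a : Fin (G.rank i) → R) :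
    L.shiftD i a ∈ (maximalIdeal R • ⊤ : Submodule R (Fin (shiftRank G.rank i) → R)) := by
  cases i with
  | zero => exact zero_mem _
  | succ i => exact L.d_mem hS hxS hx i a

/-- Applying `d` to the first coordinate gains one power of `𝔪`, and cancelling `x` loses it again.
No estimate on `t` is needed. -/
theorem coneD_snd_mem (hS : Function.Surjective (algebraMap R S))
    (hxS : RingHom.ker (algebraMap R S) = Ideal.span {x}) (hx : x ∈ maximalIdeal R)
    (hreg : (maximalIdeal R).degreeOneClass x hx ∈
      nonZeroDivisors (maximalIdeal R).AssociatedGradedRing) (i k : ℕ)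
    (p : (Fin (G.rank (i + 1)) → R) × (Fin (G.rank i) → R))
    (hp : (L.coneD i p).1 ∈ (maximalIdeal R ^ k • ⊤ : Submodule R (Fin (G.rank i) → R))) :
    (L.coneD i p).2 ∈
      (maximalIdeal R ^ k • ⊤ : Submodule R (Fin (shiftRank G.rank i) → R)) := by
  refine Ideal.smul_mem_pow_smul_top hx hreg ?_
  rw [← neg_mem_iff, ← L.shiftD_coneD]
  exact LinearMap.map_mem_pow_succ_smul_top (L.shiftD_mem hS hxS hx i) hp

variable [IsNoetherianRing R]

theorem coneD_eq_zero (hx : x ∈ maximalIdeal R)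
    (hreg : (maximalIdeal R).degreeOneClass x hx ∈
      nonZeroDivisors (maximalIdeal R).AssociatedGradedRing) (i : ℕ)
    (p : (Fin (G.rank (i + 1)) → R) × (Fin (G.rank i) → R)) (hp : (L.coneD i p).1 = 0) :
    L.coneD i p = 0 := by
  refine Prod.ext hp (IsLocalRing.smul_pi_eq_zero hx hreg ?_)
  rw [← neg_eq_zero, ← L.shiftD_coneD, hp, map_zero]

theorem exact_coneD (hS : Function.Surjective (algebraMap R S))
    (hxS : RingHom.ker (algebraMap R S) = Ideal.span {x}) (hx : x ∈ maximalIdeal R)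
    (hreg : (maximalIdeal R).degreeOneClass x hx ∈
      nonZeroDivisors (maximalIdeal R).AssociatedGradedRing) (i : ℕ) :
    Function.Exact (L.coneD (i + 1)) (L.coneD i) := by
  have hcomp : ∀ p, L.coneD i (L.coneD (i + 1) p) = 0 := by
    intro p
    refine L.coneD_eq_zero hx hreg i _ ?_
    change L.d i (L.coneD (i + 1) p).1 + x • (L.coneD (i + 1) p).2 = 0
    -- `L.d i` is `L.shiftD (i + 1)` by definition.
    rw [show L.d i (L.coneD (i + 1) p).1 = _ from L.shiftD_coneD (i + 1) p]
    exact neg_add_cancel _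
  intro p
  refine ⟨fun hp => ?_, ?_⟩
  · obtain ⟨a, b⟩ := p
    have h1 : L.d i a + x • b = 0 := congrArg Prod.fst hp
    have h2 : G.d i (piReduction R S _ a) = 0 := by
      have := congrArg (piReduction R S _) h1
      rwa [map_add, piReduction_smul_eq_zero hxS, add_zero, map_zero, L.reduction_d] at this
    obtain ⟨α, hα⟩ := (G.exact_d i _).1 h2
    obtain ⟨a', rfl⟩ := piReduction_surjective hS _ α
    obtain ⟨b', hb'⟩ := exists_smul_eq_of_piReduction_eq_zero (S := S) hxS
      (a := a - L.d (i + 1) a') (by rw [map_sub, L.reduction_d, hα, sub_self])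
    refine ⟨(a', b'), ?_⟩
    have h3 : (L.coneD (i + 1) (a', b')).1 = a := by
      rw [coneD_apply, ← hb']
      exact add_sub_cancel _ _
    -- Both `(a, b)` and the boundary of `(a', b')` are cycles with first coordinate `a`; regularity
    -- of `x` makes their second coordinates agree.
    refine Prod.ext h3 ?_
    have h4 : L.d i (L.coneD (i + 1) (a', b')).1 + x • (L.coneD (i + 1) (a', b')).2 = 0 :=
      congrArg Prod.fst (hcomp (a', b'))
    rw [h3, ← h1] at h4
    refine sub_eq_zero.1 (IsLocalRing.smul_pi_eq_zero hx hreg ?_)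
    rw [smul_sub, sub_eq_zero]
    exact add_left_cancel h4
  · rintro ⟨q, rfl⟩
    exact hcomp q

variable [Module R M] [IsScalarTower R S M]

/-- The minimal free resolution over `R` of a module over `S = R / (x)`. -/
def resolution (hS : Function.Surjective (algebraMap R S))
    (hxS : RingHom.ker (algebraMap R S) = Ideal.span {x}) (hx : x ∈ maximalIdeal R)
    (hreg : (maximalIdeal R).degreeOneClass x hx ∈
      nonZeroDivisors (maximalIdeal R).AssociatedGradedRing) : MinimalFreeResolution R M where
  rank i := G.rank i + shiftRank G.rank i
  d i := (finAddPiEquiv R (G.rank i) (shiftRank G.rank i)).symm.toLinearMap ∘ₗ L.coneD i ∘ₗ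
    (finAddPiEquiv R (G.rank (i + 1)) (G.rank i)).toLinearMap
  aug := G.aug.restrictScalars R ∘ₗ piReduction R S (G.rank 0) ∘ₗ LinearMap.fst R _ _ ∘ₗ
    (finAddPiEquiv R (G.rank 0) 0).toLinearMap
  aug_surjective := G.aug_surjective.comp ((piReduction_surjective hS _).comp
    (Prod.fst_surjective.comp (finAddPiEquiv R (G.rank 0) 0).surjective))
  exact_aug := by
    intro y
    change G.aug (piReduction R S _ (finAddPiEquiv R (G.rank 0) 0 y).1) = 0 ↔
      ∃ z, (finAddPiEquiv R (G.rank 0) 0).symm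
        (L.coneD 0 (finAddPiEquiv R (G.rank 1) (G.rank 0) z)) = y
    refine ⟨fun hy => ?_, ?_⟩
    · obtain ⟨α, hα⟩ := (G.exact_aug _).1 hy
      obtain ⟨a, rfl⟩ := piReduction_surjective hS _ α
      obtain ⟨b, hb⟩ := exists_smul_eq_of_piReduction_eq_zero (S := S) hxS
        (a := (finAddPiEquiv R (G.rank 0) 0 y).1 - L.d 0 a)
        (by rw [map_sub, L.reduction_d, hα, sub_self])
      refine ⟨(finAddPiEquiv R (G.rank 1) (G.rank 0)).symm (a, b), ?_⟩
      rw [LinearEquiv.apply_symm_apply, LinearEquiv.symm_apply_eq, coneD_apply, ← hb]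
      exact Prod.ext (add_sub_cancel _ _) (funext fun i => i.elim0)
    · rintro ⟨z, rfl⟩
      rw [LinearEquiv.apply_symm_apply]
      change G.aug (piReduction R S _ (L.d 0 _ + x • _)) = 0
      rw [map_add, piReduction_smul_eq_zero hxS, add_zero, L.reduction_d,
        G.exact_aug.apply_apply_eq_zero]
  exact_d := by
    intro i y
    change (finAddPiEquiv R (G.rank i) (shiftRank G.rank i)).symm
        (L.coneD i (finAddPiEquiv R (G.rank (i + 1)) (G.rank i) y)) = 0 ↔
      ∃ z, (finAddPiEquiv R (G.rank (i + 1)) (G.rank i)).symm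
        (L.coneD (i + 1) (finAddPiEquiv R (G.rank (i + 2)) (G.rank (i + 1)) z)) = y
    rw [LinearEquiv.map_eq_zero_iff, L.exact_coneD hS hxS hx hreg i _]
    simp_rw [LinearEquiv.symm_apply_eq]
    exact ((finAddPiEquiv R (G.rank (i + 2)) (G.rank (i + 1))).surjective.exists (p := fun z =>
      L.coneD (i + 1) z = finAddPiEquiv R (G.rank (i + 1)) (G.rank i) y))
  minimal := by
    rintro i _ ⟨y, rfl⟩
    have h1 : (L.coneD i (finAddPiEquiv R (G.rank (i + 1)) (G.rank i) y)).1 ∈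
        (maximalIdeal R • ⊤ : Submodule R (Fin (G.rank i) → R)) :=
      add_mem (L.d_mem hS hxS hx i _) (Submodule.smul_mem_smul hx trivial)
    refine finAddPiEquiv_mem_smul_top.2 ?_
    rw [LinearMap.comp_apply, LinearEquiv.coe_coe, LinearEquiv.apply_symm_apply]
    have h2 := L.coneD_snd_mem hS hxS hx hreg i 1 _ ((pow_one (maximalIdeal R)).symm ▸ h1)
    rw [pow_one] at h2
    exact ⟨h1, h2⟩

/-- Given a cycle `α` of `lin G`, lift `α` to `a` and `d α` to `e`, both at the same filtration
depth, and correct by `b` with `d a + x b = e`. Then `(a, b)` represents a cycle of `lin F`. -/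
theorem isZero_homology_linearPart (hS : Function.Surjective (algebraMap R S))
    (hxS : RingHom.ker (algebraMap R S) = Ideal.span {x}) (hx : x ∈ maximalIdeal R)
    (hreg : (maximalIdeal R).degreeOneClass x hx ∈
      nonZeroDivisors (maximalIdeal R).AssociatedGradedRing) (j : ℕ)
    (h : Limits.IsZero ((L.resolution hS hxS hx hreg).linearPart.homology (j + 1))) :
    Limits.IsZero (G.linearPart.homology (j + 1)) := by
  rw [isZero_homology_linearPart_iff_forall_mem] at h ⊢
  intro n α hα hdα
  obtain ⟨a, ha, rfl⟩ := exists_mem_piReduction_eq hS hα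
  rw [← L.reduction_d] at hdα
  obtain ⟨e, he, hed⟩ := exists_mem_piReduction_eq hS hdα
  obtain ⟨b, hb⟩ := exists_smul_eq_of_piReduction_eq_zero (S := S) hxS (a := e - L.d j a)
    (by rw [map_sub, hed, sub_self])
  have hab : (L.coneD j (a, b)).1 = e := by
    rw [coneD_apply, ← hb]
    exact add_sub_cancel _ _
  have hb' : b ∈ (maximalIdeal R ^ (n - (j + 1)) • ⊤ : Submodule R (Fin (G.rank j) → R)) := by
    -- Here the truncated exponent is `0`. The case must be separated, since for `n < j` the vector
    -- `e` is not restricted at all and regularity cannot be used.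
    by_cases hn : n ≤ j + 1
    · rw [Nat.sub_eq_zero_of_le hn, pow_zero, Ideal.one_eq_top, Submodule.top_smul]
      trivial
    refine Ideal.smul_mem_pow_smul_top hx hreg ?_
    rw [← hb]
    refine sub_mem (Submodule.smul_mono_left (Ideal.pow_le_pow_right (by omega)) he) ?_
    exact LinearMap.map_mem_pow_succ_smul_top (L.d_mem hS hxS hx j) ha
  obtain ⟨z, hz, hz'⟩ := h n ((finAddPiEquiv R (G.rank (j + 1)) (G.rank j)).symm (a, b))
    (finAddPiEquiv_mem_smul_top.2 (by
      rw [LinearEquiv.apply_symm_apply]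
      exact ⟨ha, hb'⟩))
    (by
      change (finAddPiEquiv R (G.rank j) (shiftRank G.rank j)).symm
        (L.coneD j (finAddPiEquiv R (G.rank (j + 1)) (G.rank j)
          ((finAddPiEquiv R (G.rank (j + 1)) (G.rank j)).symm (a, b)))) ∈ _
      refine finAddPiEquiv_mem_smul_top.2 ?_
      rw [LinearEquiv.apply_symm_apply, LinearEquiv.apply_symm_apply]
      exact ⟨hab ▸ he, L.coneD_snd_mem hS hxS hx hreg j _ _ (hab ▸ he)⟩)
  have hz1 := (finAddPiEquiv_mem_smul_top.1 hz).1
  have hz2 := (finAddPiEquiv_mem_smul_top.1 hz').1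
  refine ⟨piReduction R S _ _, piReduction_mem hS hz1, ?_⟩
  change (finAddPiEquiv R (G.rank (j + 1)) (G.rank j)
    ((finAddPiEquiv R (G.rank (j + 1)) (G.rank j)).symm (a, b) -
      (finAddPiEquiv R (G.rank (j + 1)) (G.rank j)).symm (L.coneD (j + 1)
        (finAddPiEquiv R (G.rank (j + 2)) (G.rank (j + 1)) z)))).1 ∈ _ at hz2
  rw [map_sub, LinearEquiv.apply_symm_apply, LinearEquiv.apply_symm_apply] at hz2
  -- Modulo `x` the first coordinate of the boundary of `z` becomes the differential of `G`.
  have hz3 := piReduction_mem hS hz2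
  change piReduction R S _ (a - (L.d (j + 1) _ + x • _)) ∈ _ at hz3
  rwa [map_sub, map_add, piReduction_smul_eq_zero hxS, add_zero, L.reduction_d] at hz3

end Lift

end Lift

end MinimalFreeResolution

/-! ### Comparison of linearity defects and the theorem. -/

/-- If `S = R / (x)` where the class of `x` in degree one is regular on the associated graded ring
of `R`, then the linearity defect of an `S`-module does not exceed its linearity defect
over `R`. -/
theorem linearityDefect_le_of_ker_eq_span {R : Type u} [CommRing R] [IsLocalRing R]
    [IsNoetherianRing R] {S : Type u} [CommRing S] [IsLocalRing S] [Algebra R S] (M : Type v)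
    [AddCommGroup M] [Module R M] [Module S M] [IsScalarTower R S M] {x : R}
    (hS : Function.Surjective (algebraMap R S))
    (hxS : RingHom.ker (algebraMap R S) = Ideal.span {x}) (hx : x ∈ maximalIdeal R)
    (hreg : (maximalIdeal R).degreeOneClass x hx ∈
      nonZeroDivisors (maximalIdeal R).AssociatedGradedRing) :
    linearityDefect S M ≤ linearityDefect R M := by
  refine iSup_le fun G => ?_
  obtain ⟨L⟩ := MinimalFreeResolution.Lift.nonempty G hS hxS
  refine le_trans (iSup₂_le fun i hi => ?_)
    (le_iSup MinimalFreeResolution.linearityDefect (L.resolution hS hxS hx hreg))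
  cases i with
  -- Homology in degree `0` contributes only the value `0` to the supremum, so only positive degrees
  -- need comparing.
  | zero => exact zero_le
  | succ j =>
    exact le_iSup₂_of_le (j + 1)
      (fun h => hi (L.isZero_homology_linearPart hS hxS hx hreg j h)) le_rfl

theorem corollary5p6 {R : Type u} [CommRing R] [IsLocalRing R] [IsNoetherianRing R]
    (hR : IsAbsolutelyKoszul R) (x : R) (hx : x ∈ IsLocalRing.maximalIdeal R)
    (hx2 : x ∉ IsLocalRing.maximalIdeal R ^ 2)
    (hreg : (IsLocalRing.maximalIdeal R).degreeOneClass x hx ∈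
      nonZeroDivisors (IsLocalRing.maximalIdeal R).AssociatedGradedRing) :
    ∃ _ : IsLocalRing (R ⧸ Ideal.span {x}), IsAbsolutelyKoszul (R ⧸ Ideal.span {x}) := by
  have hnt : Nontrivial (R ⧸ Ideal.span {x}) := Ideal.Quotient.nontrivial_iff.2 fun h =>
    (mem_maximalIdeal x).1 hx (Ideal.span_singleton_eq_top.1 h)
  have hloc : IsLocalRing (R ⧸ Ideal.span {x}) :=
    IsLocalRing.of_surjective' (Ideal.Quotient.mk _) Ideal.Quotient.mk_surjective
  refine ⟨hloc, ?_⟩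
  intro M _ _ _
  let _ : Module R M := Module.compHom M (algebraMap R (R ⧸ Ideal.span {x}))
  have : IsScalarTower R (R ⧸ Ideal.span {x}) M := IsScalarTower.of_algebraMap_smul fun _ _ => rfl
  have : Module.Finite R M := Module.Finite.trans (R ⧸ Ideal.span {x}) M
  have hS : Function.Surjective (algebraMap R (R ⧸ Ideal.span {x})) := Ideal.Quotient.mk_surjective
  have hxS : RingHom.ker (algebraMap R (R ⧸ Ideal.span {x})) = Ideal.span {x} := Ideal.mk_ker
  exact (linearityDefect_le_of_ker_eq_span M hS hxS hx hreg).trans_lt (hR M)
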